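/- For $n\ge 1$ let $B_n$ be the braid group with generators $\sigma_1,\dots,\sigma_{n-1}$ and relations $\sigma_i\sigma_{i+1}\sigma_i=\sigma_{i+1}\sigma_i\sigma_{i+1}$ for $1\le i\le n-2$ and $\sigma_i\sigma_j=\sigma_j\sigma_i$ for $|i-j|>1$. It acts on the right on the free group $F_n$ with basis $x_1,\dots,x_n$ by automorphisms (the Artin action), determined by \[ x_i^{\sigma_i}=x_ix_{i+1}x_i^{-1},\qquad x_{i+1}^{\sigma_i}=x_i,\qquad x_j^{\sigma_i}=x_j\ \text{ for } j\ne i,i+1 , \] and $x^{\beta\gamma}=(x^{\beta})^{\gamma}$. A bi-ordering of a group $G$ is a strict total ordering $<$ of $G$ such that $f<g$ implies $hf<hg$ and $fh<gh$ for all $f,g,h\in G$. A braid $\beta\in B_n$ is called order-preserving if there is a bi-ordering $<$ of $F_n$ such that, for all $f,g\in F_n$, $f<g$ if and only if $f^{\beta}<g^{\beta}$. Regard $B_{n-1}$ as a subgroup of $B_n$ through the standard inclusion $\sigma_i\mapsto\sigma_i$ ($1\le i\le n-2$). Proposition. If $n\ge 3$ and $\beta\in B_n$, then there exists $\alpha\in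 B_{n-1}$ such that $\beta\alpha$ is order-preserving. -/

import Mathlib

/-- The relators of Artin's presentation of `B_n`; the index `i : Fin (n - 1)` is zero-based and
stands for the generator `σ_{i+1}`. -/
def braidRels (n : ℕ) : Set (FreeGroup (Fin (n - 1))) :=
  {r | ∃ i j : Fin (n - 1), (i : ℕ) + 1 = j ∧
      r = (FreeGroup.of i * FreeGroup.of j * FreeGroup.of i) *
        (FreeGroup.of j * FreeGroup.of i * FreeGroup.of j)⁻¹} ∪
  {r | ∃ i j : Fin (n - 1), ((i : ℕ) + 1 < j ∨ (j : ℕ) + 1 < i) ∧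
      r = (FreeGroup.of i * FreeGroup.of j) * (FreeGroup.of j * FreeGroup.of i)⁻¹}

/-- The braid group `B_n`, by Artin's presentation. -/
abbrev BraidGroup (n : ℕ) : Type := PresentedGroup (braidRels n)

namespace BraidGroup

/-- The standard generator `σ_{i+1}` of `B_n` (zero-based index `i : Fin (n - 1)`). -/
def gen {n : ℕ} (i : Fin (n - 1)) : BraidGroup n := PresentedGroup.of i

theorem gen_braid {n : ℕ} {i j : Fin (n - 1)} (h : (i : ℕ) + 1 = j) :
    gen i * gen j * gen i = gen j * gen i * gen j := by
  have := PresentedGroup.one_of_mem (rels := braidRels n) (Or.inl ⟨i, j, h, rfl⟩)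
  rw [map_mul, map_inv, mul_inv_eq_one] at this
  rw [map_mul, map_mul, map_mul, map_mul] at this
  exact this

theorem gen_comm {n : ℕ} {i j : Fin (n - 1)} (h : (i : ℕ) + 1 < j ∨ (j : ℕ) + 1 < i) :
    gen i * gen j = gen j * gen i := by
  have := PresentedGroup.one_of_mem (rels := braidRels n) (Or.inr ⟨i, j, h, rfl⟩)
  rw [map_mul, map_inv, mul_inv_eq_one] at this
  rw [map_mul, map_mul] at this
  exact this

/-- A family of group elements that satisfies the braid relations defines a homomorphism
from the braid group. -/
def lift {n : ℕ} {G : Type*} [Group G] (f : Fin (n - 1) → G)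
    (h₁ : ∀ i j : Fin (n - 1), (i : ℕ) + 1 = j → f i * f j * f i = f j * f i * f j)
    (h₂ : ∀ i j : Fin (n - 1), ((i : ℕ) + 1 < j ∨ (j : ℕ) + 1 < i) → f i * f j = f j * f i) :
    BraidGroup n →* G :=
  PresentedGroup.toGroup (f := f) (by
    rintro r (⟨i, j, h, rfl⟩ | ⟨i, j, h, rfl⟩)
    · simpa [mul_inv_eq_one] using (mul_inv_eq_one.2 (h₁ i j h))
    · simpa [mul_inv_eq_one] using (mul_inv_eq_one.2 (h₂ i j h)))

theorem lift_gen {n : ℕ} {G : Type*} [Group G] (f : Fin (n - 1) → G) (h₁ h₂)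
    (i : Fin (n - 1)) : lift f h₁ h₂ (gen i) = f i :=
  PresentedGroup.toGroup.of _

/-- The standard inclusion `B_m → B_n` for `m ≤ n`, sending each `σ_i` to `σ_i`. -/
def incl {m n : ℕ} (h : m ≤ n) : BraidGroup m →* BraidGroup n :=
  lift (fun i => gen (Fin.castLE (Nat.sub_le_sub_right h 1) i))
    (fun _ _ hij => gen_braid hij) (fun _ _ hij => gen_comm hij)

end BraidGroup

theorem mulAut_freeGroup_ext {ι : Type*} {f g : MulAut (FreeGroup ι)}
    (h : ∀ j, f (FreeGroup.of j) = g (FreeGroup.of j)) : f = g := by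
  have : f.toMonoidHom = g.toMonoidHom := by
    ext j
    exact h j
  ext x
  exact DFunLike.congr_fun this x

section Artin

variable {ι : Type*} [DecidableEq ι]

/-- The endomorphism `x_a ↦ x_a x_b x_a⁻¹`, `x_b ↦ x_a`, `x_j ↦ x_j` otherwise. -/
def artinHom (a b : ι) : FreeGroup ι →* FreeGroup ι :=
  FreeGroup.lift fun j =>
    if j = a then FreeGroup.of a * FreeGroup.of b * (FreeGroup.of a)⁻¹
    else if j = b then FreeGroup.of a
    else FreeGroup.of j

/-- The inverse of `artinHom a b` (for `a ≠ b`). -/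
def artinInvHom (a b : ι) : FreeGroup ι →* FreeGroup ι :=
  FreeGroup.lift fun j =>
    if j = a then FreeGroup.of b
    else if j = b then (FreeGroup.of b)⁻¹ * FreeGroup.of a * FreeGroup.of b
    else FreeGroup.of j

/-- `artinHom a b` as an automorphism. -/
def artinAut (a b : ι) (hab : a ≠ b) : MulAut (FreeGroup ι) :=
  MonoidHom.toMulEquiv (artinHom a b) (artinInvHom a b)
    (by
      ext j
      by_cases h1 : j = a
      · subst h1; simp [artinHom, artinInvHom, hab.symm, mul_assoc]
      · by_cases h2 : j = b
        · subst h2; simp [artinHom, artinInvHom, h1]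
        · simp [artinHom, artinInvHom, h1, h2])
    (by
      ext j
      by_cases h1 : j = a
      · subst h1; simp [artinHom, artinInvHom, hab.symm]
      · by_cases h2 : j = b
        · subst h2; simp [artinHom, artinInvHom, h1, mul_assoc]
        · simp [artinHom, artinInvHom, h1, h2])

theorem artinAut_of (a b : ι) (hab : a ≠ b) (j : ι) :
    artinAut a b hab (FreeGroup.of j) =
      if j = a then FreeGroup.of a * FreeGroup.of b * (FreeGroup.of a)⁻¹
      else if j = b then FreeGroup.of a
      else FreeGroup.of j := by
  simp [artinAut, artinHom]

theorem artinAut_braid {a b c : ι} (hab : a ≠ b) (hbc : b ≠ c) (hac : a ≠ c) :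
    artinAut a b hab * artinAut b c hbc * artinAut a b hab =
      artinAut b c hbc * artinAut a b hab * artinAut b c hbc := by
  apply mulAut_freeGroup_ext
  intro j
  by_cases h1 : j = a
  · subst h1
    simp [artinAut_of, hab, hac, hab.symm, hac.symm, hbc.symm, mul_assoc]
  · by_cases h2 : j = b
    · subst h2
      simp [artinAut_of, hab, hac, hab.symm, hac.symm, hbc.symm, mul_assoc]
    · by_cases h3 : j = c
      · subst h3
        simp [artinAut_of, hab, hac, hab.symm, hac.symm, hbc.symm, mul_assoc]
      · simp [artinAut_of, h1, h2, h3]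

theorem artinAut_comm {a b c d : ι} (hab : a ≠ b) (hcd : c ≠ d) (hac : a ≠ c) (had : a ≠ d)
    (hbc : b ≠ c) (hbd : b ≠ d) :
    artinAut a b hab * artinAut c d hcd = artinAut c d hcd * artinAut a b hab := by
  apply mulAut_freeGroup_ext
  intro j
  by_cases h1 : j = a
  · subst h1
    simp [artinAut_of, hac, had, hbc, hbd]
  · by_cases h2 : j = b
    · subst h2
      simp [artinAut_of, hab.symm, hac, had, hbc, hbd]
    · by_cases h3 : j = c
      · subst h3
        simp [artinAut_of, hac.symm, had.symm, hbc.symm, hbd.symm]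
      · by_cases h4 : j = d
        · subst h4
          simp [artinAut_of, hcd.symm, hac.symm, had.symm, hbc.symm, hbd.symm]
        · simp [artinAut_of, h1, h2, h3, h4]

end Artin

namespace BraidGroup

/-- The automorphism of `F_n` by which `σ_{i+1}` acts: with the zero-based generators `x_j`,
`x_i ↦ x_i x_{i+1} x_i⁻¹`, `x_{i+1} ↦ x_i`, and `x_j ↦ x_j` otherwise. -/
def artinGen {n : ℕ} (i : Fin (n - 1)) : MulAut (FreeGroup (Fin n)) :=
  artinAut (⟨i, by omega⟩ : Fin n) (⟨i + 1, by omega⟩ : Fin n) (by simp)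

/-- The Artin action of `B_n` on `F_n`. It is a right action, `x ^ (β γ) = (x ^ β) ^ γ`, hence a
homomorphism to the opposite of the automorphism group (whose product is composition with the
right factor applied first). -/
def artinAction (n : ℕ) : BraidGroup n →* (MulAut (FreeGroup (Fin n)))ᵐᵒᵖ :=
  lift (fun i => MulOpposite.op (artinGen i))
    (by
      rintro ⟨i, hi⟩ ⟨j, hj⟩ h
      simp only at h
      subst h
      simp only [← MulOpposite.op_mul, ← mul_assoc]
      exact congrArg MulOpposite.op
        (artinAut_braid (by simp) (by simp) (by simp [Fin.ext_iff]; omega)))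
    (by
      rintro ⟨i, hi⟩ ⟨j, hj⟩ h
      simp only at h
      simp only [← MulOpposite.op_mul]
      refine congrArg MulOpposite.op (artinAut_comm _ _ ?_ ?_ ?_ ?_) <;>
      · simp only [ne_eq, Fin.mk.injEq]
        omega)

/-- The automorphism `x ↦ x ^ β` of `F_n` by which the braid `β` acts. -/
def toAut {n : ℕ} (β : BraidGroup n) : MulAut (FreeGroup (Fin n)) :=
  (artinAction n β).unop

end BraidGroup

theorem BraidGroup.toAut_gen {n : ℕ} (i : Fin (n - 1)) :
    (gen i : BraidGroup n).toAut = artinGen i := by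
  simp [toAut, artinAction, lift_gen]

theorem BraidGroup.toAut_mul_apply {n : ℕ} (β γ : BraidGroup n) (x : FreeGroup (Fin n)) :
    (β * γ).toAut x = γ.toAut (β.toAut x) := by
  simp [toAut]

/-- A bi-ordering of a group: a strict total ordering invariant under multiplication
on both sides. -/
structure IsBiOrdering {G : Type*} [Group G] (r : G → G → Prop) : Prop where
  irrefl : ∀ f, ¬ r f f
  trans : ∀ f g h, r f g → r g h → r f h
  total : ∀ f g, r f g ∨ f = g ∨ r g f
  mul_left : ∀ f g h, r f g → r (h * f) (h * g)
  mul_right : ∀ f g h, r f g → r (f * h) (g * h)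

/-- An automorphism of a group is order-preserving if some bi-ordering is invariant under it. -/
def IsOrderPreservingAut {G : Type*} [Group G] (φ : MulAut G) : Prop :=
  ∃ r : G → G → Prop, IsBiOrdering r ∧ ∀ f g, r f g ↔ r (φ f) (φ g)

/-- A braid is order-preserving if it acts on the free group by an order-preserving
automorphism. -/
def BraidGroup.IsOrderPreserving {n : ℕ} (β : BraidGroup n) : Prop :=
  IsOrderPreservingAut β.toAut

/-! A braid acts by `x_j ↦ u_j x_{π(j)} u_j⁻¹`. Suppose its permutation `π` fixes `o`. The exponent
sum of `x_o` maps `F_n` onto `ℤ`, with kernel `K` free on the conjugates `x_o^k x_j x_o^{-k}`, `j ≠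
o`, indexed by pairs `(j, k)`. The braid preserves this exponent sum and, modulo commutators of `K`,
permutes the basis by `(j, k) ↦ (π(j), k + m_j)`, where `m_j` is the exponent sum of `x_o` in `u_j`.
Conjugation by `h` likewise acts by `(j, k) ↦ (j, k + e)`, where `e` is the exponent sum of `x_o` in
`h`.

The Magnus ordering of a free group on an ordered basis compares leading coefficients of Magnus
expansions. In lowest degree only the action modulo commutators is visible, so every endomorphism
that induces an order isomorphism of the basis preserves it (`MagnusPos.map`). Hence an order of the
pairs `(j, k)` that is invariant under shifts and under the braid gives an invariant bi-ordering of
`F_n`: compare exponent sums first, then use the Magnus ordering of `K`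
(`isOrderPreservingAut_of_strictMono`).

For a pure braid the lexicographic order of the pairs is invariant. If `π` swaps `a` and `b`, the
two copies of `ℤ` over `a` and `b` can be interleaved invariantly when `m_a + m_b` is odd
(`ActsBy.isOrderPreserving_of_swap`).

Multiplying by a braid on the first `n - 1` strands makes the permutation trivial or a transposition
of the last strand with some `a`. In the latter case a third strand `o` next to `a` exists because
`n ≥ 3`, and the square of the generator crossing `a` and `o` corrects the parity. -/

/-! ### Fox calculus on the integral group ring of a free group. -/

noncomputable section Magnus

open MonoidAlgebra

variable {S : Type*} [DecidableEq S]

/-- The permutations `a ↦ (a - [s = t]) x_t⁻¹` of the group ring, as an action of the free group. -/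
def foxPerm (s : S) : FreeGroup S →* Equiv.Perm (MonoidAlgebra ℤ (FreeGroup S)) :=
  FreeGroup.lift fun t =>
    { toFun := fun a => (a - if s = t then 1 else 0) * of ℤ _ (FreeGroup.of t)⁻¹
      invFun := fun a => a * of ℤ _ (FreeGroup.of t) + if s = t then 1 else 0
      left_inv := fun a => by
        simp only [mul_assoc, ← map_mul, inv_mul_cancel, map_one, mul_one, sub_add_cancel]
      right_inv := fun a => by
        simp only [mul_assoc, ← map_mul, mul_inv_cancel, map_one, mul_one, add_sub_cancel_right] }

/-- Each permutation is affine with linear part right multiplication by `g⁻¹`, so its translation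
part is a cocycle in `g`. This gives the product rule; well-definedness comes for free, because an
action of a free group may be prescribed on generators. -/
theorem foxPerm_apply (s : S) (g : FreeGroup S) (a : MonoidAlgebra ℤ (FreeGroup S)) :
    foxPerm s g a = a * of ℤ _ g⁻¹ + foxPerm s g 0 := by
  induction g using FreeGroup.induction_on generalizing a with
  | C1 => rw [map_one, inv_one, map_one, mul_one, Equiv.Perm.one_apply, Equiv.Perm.one_apply, add_zero]
  | of t => 
    simp only [foxPerm, FreeGroup.lift_apply_of, Equiv.coe_fn_mk]
    rw [sub_mul, sub_mul, zero_mul, zero_sub, sub_eq_add_neg]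
  | inv_of t _ =>
    simp only [map_inv, foxPerm, FreeGroup.lift_apply_of, inv_inv]
    simp [Equiv.Perm.inv_def, Equiv.symm]
  | mul g h ihg ihh =>
    rw [map_mul, Equiv.Perm.mul_apply, Equiv.Perm.mul_apply, ihg, ihh, ihg (foxPerm s h 0), add_mul,
      mul_assoc, ← map_mul, mul_inv_rev, add_assoc]

/-- The Fox derivative of a group element. -/
def foxDerivGroup (s : S) (g : FreeGroup S) : MonoidAlgebra ℤ (FreeGroup S) := foxPerm s g⁻¹ 0

theorem foxDerivGroup_mul (s : S) (g h : FreeGroup S) :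
    foxDerivGroup s (g * h) = foxDerivGroup s g * of ℤ _ h + foxDerivGroup s h := by
  rw [foxDerivGroup, mul_inv_rev, map_mul, Equiv.Perm.mul_apply, foxPerm_apply, inv_inv]
  rfl

theorem foxDerivGroup_of (s t : S) :
    foxDerivGroup s (FreeGroup.of t) = if s = t then 1 else 0 := by
  simp only [foxDerivGroup, map_inv, foxPerm, FreeGroup.lift_apply_of]
  simp [Equiv.Perm.inv_def, Equiv.symm]

theorem foxDerivGroup_one (s : S) : foxDerivGroup s 1 = 0 := by
  simp [foxDerivGroup]

/-- The Fox derivative on the group ring. -/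
def foxDeriv (s : S) : MonoidAlgebra ℤ (FreeGroup S) →+ MonoidAlgebra ℤ (FreeGroup S) :=
  liftNC (Int.castAddHom _) (foxDerivGroup s)

theorem foxDeriv_of (s : S) (g : FreeGroup S) : foxDeriv s (of ℤ _ g) = foxDerivGroup s g := by
  simp [foxDeriv, of, liftNC_single]

/-- The augmentation of the group ring. -/
def augmentation (S : Type*) : MonoidAlgebra ℤ (FreeGroup S) →+* ℤ :=
  (MonoidAlgebra.lift ℤ ℤ (FreeGroup S) 1).toRingHom

theorem augmentation_of {S : Type*} (g : FreeGroup S) : augmentation S (of ℤ _ g) = 1 := by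
  simp [augmentation]

theorem augmentation_mapDomain {S T : Type*} (ψ : FreeGroup S →* FreeGroup T)
    (a : MonoidAlgebra ℤ (FreeGroup S)) :
    augmentation T (mapDomainRingHom ℤ ψ a) = augmentation S a := by
  induction a using MonoidAlgebra.induction_on with
  | of g => rw [augmentation_of]; simp [augmentation]
  | add x y hx hy => simp only [map_add, hx, hy]
  | smul r x hx => simp only [map_zsmul, hx]

theorem foxDeriv_mul (s : S) (a b : MonoidAlgebra ℤ (FreeGroup S)) :
    foxDeriv s (a * b) = foxDeriv s a * b + augmentation S a • foxDeriv s b := by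
  induction a using MonoidAlgebra.induction_on with
  | of g =>
    induction b using MonoidAlgebra.induction_on with
    | of h => rw [← map_mul, foxDeriv_of, foxDeriv_of, foxDeriv_of, foxDerivGroup_mul,
        augmentation_of, one_smul]
    | add x y hx hy => rw [mul_add, map_add, hx, hy, map_add, mul_add, smul_add]; abel
    | smul r x hx => rw [mul_smul_comm, map_zsmul, hx, map_zsmul, mul_smul_comm, smul_add,
        smul_comm r]
  | add x y hx hy => rw [add_mul, map_add, hx, hy, map_add, map_add, add_mul, add_smul]; abel
  | smul r x hx => rw [smul_mul_assoc, map_zsmul, hx, map_zsmul, map_zsmul, smul_add,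
        smul_mul_assoc, smul_assoc]

theorem foxDeriv_one (s : S) : foxDeriv s 1 = 0 := by
  rw [← map_one (of ℤ (FreeGroup S)), foxDeriv_of, foxDerivGroup_one]

/-- The basis used later is infinite, so the sum in the fundamental formula needs this finiteness.
-/
theorem finite_support_foxDeriv (a : MonoidAlgebra ℤ (FreeGroup S)) :
    (Function.support fun s => foxDeriv s a).Finite := by
  have key : ∀ g : FreeGroup S, (Function.support fun s => foxDeriv s (of ℤ _ g)).Finite := by
    have hmul : ∀ g h : FreeGroup S, (Function.support fun s => foxDeriv s (of ℤ _ g)).Finite →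
        (Function.support fun s => foxDeriv s (of ℤ _ h)).Finite →
        (Function.support fun s => foxDeriv s (of ℤ _ (g * h))).Finite := by
      intro g h hg hh
      refine (hg.union hh).subset fun s hs => ?_
      by_contra hc
      simp only [Set.mem_union, Function.mem_support, not_or, not_not] at hc
      rw [Function.mem_support, map_mul, foxDeriv_mul, hc.1, hc.2] at hs
      simp at hs
    intro g
    induction g using FreeGroup.induction_on with
    | C1 => simp only [map_one, foxDeriv_one, Function.support_fun_zero, Set.finite_empty]
    | of t =>
      refine (Set.finite_singleton t).subset fun s hs => ?_
      by_contra hc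
      rw [Function.mem_support, foxDeriv_of, foxDerivGroup_of,
        if_neg (fun h => hc (Set.mem_singleton_iff.2 h))] at hs
      exact hs rfl
    | inv_of t ht =>
      refine ht.subset fun s hs hc => hs ?_
      simp only at hc
      have h1 := foxDeriv_one s
      rw [← map_one (of ℤ (FreeGroup S)), ← mul_inv_cancel (FreeGroup.of t), map_mul, foxDeriv_mul,
        hc, augmentation_of, one_smul, zero_mul, zero_add] at h1
      exact h1
    | mul g h hg hh => exact hmul g h hg hh
  induction a using MonoidAlgebra.induction_on with
  | of g => exact key g
  | add x y hx hy =>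
    refine (hx.union hy).subset fun s hs => ?_
    by_contra hc
    simp only [Set.mem_union, Function.mem_support, not_or, not_not] at hc
    rw [Function.mem_support, map_add, hc.1, hc.2] at hs
    simp at hs
  | smul r x hx =>
    refine hx.subset fun s hs hc => hs ?_
    simp only at hc ⊢
    rw [map_zsmul, hc, smul_zero]

theorem finite_support_mul_foxDeriv (f : S → MonoidAlgebra ℤ (FreeGroup S))
    (a : MonoidAlgebra ℤ (FreeGroup S)) :
    (Function.support fun s => f s * foxDeriv s a).Finite :=
  (finite_support_foxDeriv a).subset fun s hs hc => hs (by simp only at hc ⊢; rw [hc, mul_zero])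

/-- The fundamental formula of Fox calculus. -/
theorem eq_augmentation_add_finsum (a : MonoidAlgebra ℤ (FreeGroup S)) :
    a = augmentation S a • 1 + ∑ᶠ s, (of ℤ _ (FreeGroup.of s) - 1) * foxDeriv s a := by
  set f : S → MonoidAlgebra ℤ (FreeGroup S) := fun s => of ℤ _ (FreeGroup.of s) - 1 with hf
  have hmul : ∀ a b : MonoidAlgebra ℤ (FreeGroup S), ∑ᶠ s, f s * foxDeriv s (a * b) =
      (∑ᶠ s, f s * foxDeriv s a) * b + augmentation S a • ∑ᶠ s, f s * foxDeriv s b := by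
    intro a b
    rw [finsum_mul' _ _ (finite_support_mul_foxDeriv f a),
      smul_finsum' _ (finite_support_mul_foxDeriv f b), ← finsum_add_distrib]
    · refine finsum_congr fun s => ?_
      rw [foxDeriv_mul, mul_add, mul_assoc, mul_smul_comm]
    · exact (finite_support_mul_foxDeriv f a).subset fun s hs hc => hs (by
        simp only at hc ⊢; rw [hc, zero_mul])
    · exact (finite_support_mul_foxDeriv f b).subset fun s hs hc => hs (by
        simp only at hc ⊢; rw [hc, smul_zero])
  have key : ∀ g : FreeGroup S, ∑ᶠ s, f s * foxDeriv s (of ℤ _ g) = of ℤ _ g - 1 := by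
    intro g
    induction g using FreeGroup.induction_on with
    | C1 => simp only [map_one, foxDeriv_one, mul_zero, finsum_zero, sub_self]
    | of t =>
      rw [finsum_eq_single _ t]
      · rw [foxDeriv_of, foxDerivGroup_of, if_pos rfl, mul_one]
      · intro s hs
        rw [foxDeriv_of, foxDerivGroup_of, if_neg hs, mul_zero]
    | inv_of t ht =>
      have h1 := hmul (of ℤ _ (FreeGroup.of t)) (of ℤ _ (FreeGroup.of t)⁻¹)
      rw [ht, ← map_mul, mul_inv_cancel, augmentation_of, one_smul] at h1
      simp only [map_one, foxDeriv_one, mul_zero, finsum_zero, sub_mul, one_mul] at h1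
      rw [← map_mul, mul_inv_cancel, map_one] at h1
      rw [← sub_eq_zero, h1]
      abel
    | mul g h hg hh =>
      rw [map_mul, hmul, hg, hh, augmentation_of, one_smul, sub_mul, one_mul]
      abel
  induction a using MonoidAlgebra.induction_on with
  | of g => rw [key, augmentation_of, one_smul, add_sub_cancel]
  | add x y hx hy =>
    have : ∑ᶠ s, f s * foxDeriv s (x + y) =
        ∑ᶠ s, f s * foxDeriv s x + ∑ᶠ s, f s * foxDeriv s y := by
      rw [← finsum_add_distrib (finite_support_mul_foxDeriv f x) (finite_support_mul_foxDeriv f y)]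
      exact finsum_congr fun s => by rw [map_add, mul_add]
    rw [this, map_add, add_smul]
    nth_rewrite 1 [hx, hy]
    abel
  | smul r x hx =>
    have : ∑ᶠ s, f s * foxDeriv s (r • x) = r • ∑ᶠ s, f s * foxDeriv s x := by
      rw [smul_finsum' _ (finite_support_mul_foxDeriv f x)]
      exact finsum_congr fun s => by rw [map_zsmul, mul_smul_comm]
    rw [this, map_zsmul, smul_assoc, ← smul_add, ← hx]

/-! ### Magnus coefficients and their lowest-degree behaviour. -/

/-- The coefficients of the Magnus expansion. -/
def magnusCoeff : List S → MonoidAlgebra ℤ (FreeGroup S) →+ ℤ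
  | [] => (augmentation S).toAddMonoidHom
  | s :: w => (magnusCoeff w).comp (foxDeriv s)

theorem magnusCoeff_nil (a : MonoidAlgebra ℤ (FreeGroup S)) :
    magnusCoeff [] a = augmentation S a := rfl

theorem magnusCoeff_cons (s : S) (w : List S) (a : MonoidAlgebra ℤ (FreeGroup S)) :
    magnusCoeff (s :: w) a = magnusCoeff w (foxDeriv s a) := rfl

theorem magnusCoeff_one {w : List S} (hw : w ≠ []) : magnusCoeff w 1 = 0 := by
  cases w with
  | nil => exact absurd rfl hw
  | cons s w => rw [magnusCoeff_cons, foxDeriv_one, map_zero]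

/-- If `b` starts in degree `m`, then up to that degree only the constant term of `a` matters: in
the product rule `(D_s a) b` is evaluated at a shorter word, where `b` vanishes. -/
theorem magnusCoeff_mul {m : ℕ} {b : MonoidAlgebra ℤ (FreeGroup S)}
    (hb : ∀ v : List S, v.length < m → magnusCoeff v b = 0) (w : List S) (hw : w.length ≤ m)
    (a : MonoidAlgebra ℤ (FreeGroup S)) :
    magnusCoeff w (a * b) = augmentation S a * magnusCoeff w b := by
  induction w generalizing a with
  | nil => rw [magnusCoeff_nil, magnusCoeff_nil, map_mul]
  | cons s w ih =>
    rw [List.length_cons] at hw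
    rw [magnusCoeff_cons, foxDeriv_mul, map_add, ih (by omega), hb w (by omega), mul_zero, zero_add,
      map_zsmul, smul_eq_mul, magnusCoeff_cons]

theorem magnusCoeff_cons_mul {m : ℕ} {b : MonoidAlgebra ℤ (FreeGroup S)}
    (hb : ∀ v : List S, v.length < m → magnusCoeff v b = 0) (s : S) (w : List S)
    (hw : w.length ≤ m) {a : MonoidAlgebra ℤ (FreeGroup S)} (ha : augmentation S a = 0) :
    magnusCoeff (s :: w) (a * b) = magnusCoeff [s] a * magnusCoeff w b := by
  rw [magnusCoeff_cons, foxDeriv_mul, ha, zero_smul, add_zero, magnusCoeff_mul hb w hw]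
  rfl

/-- An endomorphism that permutes the basis modulo commutators permutes the coefficients of
lowest degree. -/
theorem magnusCoeff_map (p : S ≃ S) (ψ : FreeGroup S →* FreeGroup S)
    (hψ : ∀ s q, magnusCoeff [q] (of ℤ _ (ψ (FreeGroup.of s))) = if q = p s then 1 else 0)
    (d : ℕ) (a : MonoidAlgebra ℤ (FreeGroup S))
    (ha : ∀ v : List S, v.length < d → magnusCoeff v a = 0) (w : List S) (hw : w.length ≤ d) :
    magnusCoeff (w.map p) (mapDomainRingHom ℤ ψ a) = magnusCoeff w a := by
  induction d generalizing a w with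
  | zero =>
    obtain rfl : w = [] := List.length_eq_zero_iff.1 (by omega)
    exact augmentation_mapDomain ψ a
  | succ d ih =>
    obtain hlt | heq : w.length ≤ d ∨ w.length = d + 1 := by omega
    · exact ih a (fun v hv => ha v (by omega)) w hlt
    obtain ⟨s, w, rfl⟩ := List.exists_of_length_succ w heq
    have hlen : w.length = d := by simpa using heq
    have hD : ∀ t (v : List S), v.length < d → magnusCoeff v (foxDeriv t a) = 0 := fun t v hv =>
      ha (t :: v) (by simpa using hv)
    -- The image of `D_t a` still starts in degree at least `d`: pull the word back along `p` and
    -- use induction.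
    have hΨD : ∀ t (v : List S), v.length < d →
        magnusCoeff v (mapDomainRingHom ℤ ψ (foxDeriv t a)) = 0 := by
      intro t v hv
      have := ih _ (hD t) (v.map p.symm) (by simpa using hv.le)
      rwa [List.map_map, Equiv.self_comp_symm, List.map_id, hD t _ (by simpa using hv)] at this
    have hε : augmentation S a = 0 := ha [] (by simp)
    have hexp := congrArg (mapDomainRingHom ℤ ψ) (eq_augmentation_add_finsum a)
    rw [hε, zero_smul, zero_add, ← AddMonoidHom.coe_coe, AddMonoidHom.map_finsum _
      (finite_support_mul_foxDeriv _ a), AddMonoidHom.coe_coe] at hexp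
    -- In the image of `∑ (x_t - 1) D_t a`, the first letter `p s` selects the term `t = s`.
    rw [hexp, List.map_cons, AddMonoidHom.map_finsum]
    · rw [finsum_eq_single _ s]
      · rw [map_mul, magnusCoeff_cons_mul (hΨD s) _ _ (by simp [hlen]),
          ih _ (hD s) w hlen.le, map_sub, map_one, map_sub, magnusCoeff_one (by simp)]
        · have := hψ s (p s)
          simp only [of_apply, mapDomainRingHom_apply, mapDomain_single, if_true] at this ⊢
          rw [this, sub_zero, one_mul, magnusCoeff_cons]
        · rw [augmentation_mapDomain, map_sub, augmentation_of, map_one, sub_self]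
      · intro t ht
        rw [map_mul, magnusCoeff_cons_mul (hΨD t) _ _ (by simp [hlen]),
          map_sub, map_one, map_sub, magnusCoeff_one (by simp)]
        · have := hψ t (p s)
          rw [if_neg (by simpa using ht.symm)] at this
          simp only [of_apply, mapDomainRingHom_apply, mapDomain_single] at this ⊢
          rw [this, sub_zero, zero_mul]
        · rw [augmentation_mapDomain, map_sub, augmentation_of, map_one, sub_self]
    · refine (finite_support_mul_foxDeriv (fun s => of ℤ _ (FreeGroup.of s) - 1) a).subset
        fun s hs hc => hs ?_
      simp only at hc ⊢
      rw [hc, map_zero]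

/-- Guarantees a lexicographically largest word in the lowest degree, even over an infinite basis.
-/
theorem finite_setOf_magnusCoeff_ne_zero (d : ℕ) (a : MonoidAlgebra ℤ (FreeGroup S)) :
    {w : List S | w.length = d ∧ magnusCoeff w a ≠ 0}.Finite := by
  induction d generalizing a with
  | zero => exact (Set.finite_singleton []).subset fun w hw => List.length_eq_zero_iff.1 hw.1
  | succ d ih =>
    refine ((finite_support_foxDeriv a).biUnion fun s _ =>
      (ih (foxDeriv s a)).image (List.cons s)).subset ?_
    rintro w ⟨hw, hc⟩
    obtain ⟨s, w, rfl⟩ := List.exists_of_length_succ w hw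
    simp only [Set.mem_iUnion]
    refine ⟨s, fun h => hc ?_, w, ⟨by simpa using hw, hc⟩, rfl⟩
    rw [magnusCoeff_cons]
    simp only at h
    rw [h, map_zero]

end Magnus

/-! ### Faithfulness of the Magnus expansion. -/

noncomputable section MagnusOrder

open MonoidAlgebra

section Faithful

variable {S : Type*} [DecidableEq S]

theorem magnusCoeff_letter_mul (s t : S) (b : Bool) (v : List S) (h : FreeGroup S) (hts : t ≠ s) :
    magnusCoeff (t :: v) (of ℤ _ (FreeGroup.mk [(s, b)] * h)) =
      magnusCoeff (t :: v) (of ℤ _ h) := by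
  rw [magnusCoeff_cons, foxDeriv_of, foxDerivGroup_mul, magnusCoeff_cons, foxDeriv_of]
  suffices foxDerivGroup t (FreeGroup.mk [(s, b)]) = 0 by rw [this, zero_mul, zero_add]
  have hs : foxDerivGroup t (FreeGroup.of s) = 0 := by rw [foxDerivGroup_of, if_neg hts]
  cases b with
  | true => exact hs
  | false =>
    have h1 := foxDerivGroup_mul t (FreeGroup.of s) (FreeGroup.of s)⁻¹
    rw [mul_inv_cancel, foxDerivGroup_one, hs, zero_mul, zero_add] at h1
    exact h1.symm

theorem magnusCoeff_letter_mul_of_head?_ne (s : S) (b : Bool) (v : List S) (hv : v.head? ≠ some s)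
    (h : FreeGroup S) :
    magnusCoeff v (of ℤ _ (FreeGroup.mk [(s, b)] * h)) = magnusCoeff v (of ℤ _ h) := by
  cases v with
  | nil => rw [magnusCoeff_nil, magnusCoeff_nil, augmentation_of, augmentation_of]
  | cons t v => exact magnusCoeff_letter_mul s t b v h (by simpa using hv)

theorem magnusCoeff_cons_letter_mul (s : S) (b : Bool) (v : List S) (hv : v.head? ≠ some s)
    (h : FreeGroup S) :
    magnusCoeff (s :: v) (of ℤ _ (FreeGroup.mk [(s, b)] * h)) =
      (if b then 1 else -1) * magnusCoeff v (of ℤ _ h) + magnusCoeff (s :: v) (of ℤ _ h) := by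
  rw [magnusCoeff_cons, foxDeriv_of, foxDerivGroup_mul, magnusCoeff_cons, foxDeriv_of, map_add]
  congr 1
  have hs : foxDerivGroup s (FreeGroup.of s) = 1 := by rw [foxDerivGroup_of, if_pos rfl]
  cases b with
  | true =>
    change magnusCoeff v (foxDerivGroup s (FreeGroup.of s) * _) = _
    rw [hs, one_mul, if_pos rfl, one_mul]
  | false =>
    have h1 := foxDerivGroup_mul s (FreeGroup.of s) (FreeGroup.of s)⁻¹
    rw [mul_inv_cancel, foxDerivGroup_one, hs, one_mul] at h1
    have h2 : foxDerivGroup s (FreeGroup.mk [(s, false)]) =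
        -of ℤ _ (FreeGroup.mk [(s, false)]) := (neg_eq_of_add_eq_zero_right h1.symm).symm
    rw [h2, neg_mul, ← map_mul, map_neg, magnusCoeff_letter_mul_of_head?_ne s false v hv]
    simp

/-- Write the reduced word in syllables `s₁^{e₁} ⋯ s_r^{e_r}`. The coefficient at `s₁ ⋯ s_r` is `e₁
⋯ e_r ≠ 0`. Here `u = s₂ ⋯ s_r`, `q = e₂ ⋯ e_r` and `m = |e₁|`; the last two clauses, on words
without adjacent repetitions, keep the induction on letters going. -/
theorem exists_magnusCoeff_of_isReduced (L : List (S × Bool)) (s : S) (b : Bool)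
    (hL : FreeGroup.IsReduced ((s, b) :: L)) :
    ∃ (u : List S) (q m : ℤ), q ≠ 0 ∧ 0 < m ∧ (s :: u).IsChain (· ≠ ·) ∧
      magnusCoeff u (of ℤ _ (FreeGroup.mk ((s, b) :: L))) = q ∧
      magnusCoeff (s :: u) (of ℤ _ (FreeGroup.mk ((s, b) :: L))) = (if b then 1 else -1) * m * q ∧
      (∀ v : List S, v.IsChain (· ≠ ·) → u.length + 1 < v.length →
        magnusCoeff v (of ℤ _ (FreeGroup.mk ((s, b) :: L))) = 0) ∧
      (∀ v : List S, v.IsChain (· ≠ ·) → v.head? ≠ some s → u.length < v.length →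
        magnusCoeff v (of ℤ _ (FreeGroup.mk ((s, b) :: L))) = 0) := by
  have hmul : ∀ (s : S) b L, FreeGroup.mk ((s, b) :: L) = FreeGroup.mk [(s, b)] * FreeGroup.mk L :=
    fun s b L => rfl
  have hhead : ∀ (t : S) (v : List S), (t :: v).IsChain (· ≠ ·) → v.head? ≠ some t := by
    intro t v hv h
    cases v with
    | nil => simp at h
    | cons t' v =>
      rw [List.isChain_cons_cons] at hv
      exact hv.1 (by simpa using h.symm)
  have hvan : ∀ (s : S) b L (k : ℕ),
      (∀ v : List S, v.IsChain (· ≠ ·) → v.head? ≠ some s → k < v.length →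
        magnusCoeff v (of ℤ _ (FreeGroup.mk L)) = 0) →
      (∀ v : List S, v.IsChain (· ≠ ·) → k + 1 < v.length →
        magnusCoeff v (of ℤ _ (FreeGroup.mk L)) = 0) →
      ∀ v : List S, v.IsChain (· ≠ ·) → k + 1 < v.length →
        magnusCoeff v (of ℤ _ (FreeGroup.mk ((s, b) :: L))) = 0 := by
    intro s b L k h₁ h₂ v hv hlen
    rw [hmul]
    by_cases hs : v.head? = some s
    · cases v with
      | nil => simp at hs
      | cons t v =>
        obtain rfl : t = s := by simpa using hs
        have hv' := hhead t v hv
        rw [magnusCoeff_cons_letter_mul _ _ _ hv', h₁ v hv.tail hv' (by simpa using hlen),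
          h₂ _ hv hlen, mul_zero, zero_add]
    · rw [magnusCoeff_letter_mul_of_head?_ne _ _ _ hs, h₂ v hv hlen]
  induction L generalizing s b with
  | nil =>
    have hone : ∀ v : List S, 0 < v.length → magnusCoeff v (of ℤ _ (FreeGroup.mk [])) = 0 :=
      fun v hv => magnusCoeff_one (List.ne_nil_of_length_pos hv)
    refine ⟨[], 1, 1, one_ne_zero, one_pos, by simp, augmentation_of _, ?_,
      hvan s b [] 0 (fun v _ _ h => hone v h) (fun v _ h => hone v (by omega)), ?_⟩
    · rw [hmul, magnusCoeff_cons_letter_mul _ _ _ (by simp), magnusCoeff_nil,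
        augmentation_of, hone _ (by simp), add_zero, mul_one,
        mul_one]
    · intro v _ hs hlen
      rw [hmul, magnusCoeff_letter_mul_of_head?_ne _ _ _ hs, hone v hlen]
  | cons y L ih =>
    obtain ⟨t, b'⟩ := y
    rw [FreeGroup.isReduced_cons_cons] at hL
    obtain ⟨u, q, m, hq, hm, hu, huq, hsu, hlong, hlong'⟩ := ih t b' hL.2
    by_cases hst : s = t
    · subst hst
      obtain rfl : b = b' := hL.1 rfl
      -- The new letter extends the first syllable; reducedness forces equal signs, so no
      -- cancellation occurs.
      refine ⟨u, q, m + 1, hq, by omega, hu, ?_, ?_, hvan s b _ _ hlong' hlong, ?_⟩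
      · rw [hmul, magnusCoeff_letter_mul_of_head?_ne _ _ _ (hhead _ _ hu), huq]
      · rw [hmul, magnusCoeff_cons_letter_mul _ _ _ (hhead _ _ hu), huq, hsu]
        ring
      · intro v hv hs hlen
        rw [hmul, magnusCoeff_letter_mul_of_head?_ne _ _ _ hs, hlong' v hv hs hlen]
    · have hne : (t :: u).head? ≠ some s := by simpa using Ne.symm hst
      have hch : (s :: t :: u).IsChain (· ≠ ·) := List.isChain_cons_cons.2 ⟨hst, hu⟩
      -- The new letter opens a syllable of length one, and the old first syllable is absorbed into
      -- `u` and `q`.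
      refine ⟨t :: u, (if b' then 1 else -1) * m * q, 1, ?_, one_pos, hch, ?_, ?_,
        hvan s b _ _ (fun v hv _ hlen => hlong v hv hlen)
          (fun v hv hlen => hlong v hv (Nat.lt_of_succ_lt hlen)), ?_⟩
      · exact mul_ne_zero (mul_ne_zero (by split_ifs <;> simp) hm.ne') hq
      · rw [hmul, magnusCoeff_letter_mul_of_head?_ne _ _ _ hne, hsu]
      · rw [hmul, magnusCoeff_cons_letter_mul _ _ _ hne, hsu, hlong _ hch (by simp), add_zero,
          mul_one]
      · intro v hv hs hlen
        rw [hmul, magnusCoeff_letter_mul_of_head?_ne _ _ _ hs, hlong v hv hlen]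

/-- The Magnus expansion is faithful. -/
theorem exists_magnusCoeff_ne_zero {g : FreeGroup S} (hg : g ≠ 1) :
    ∃ w : List S, magnusCoeff w (of ℤ _ g - 1) ≠ 0 := by
  have hred : FreeGroup.IsReduced g.toWord := FreeGroup.isReduced_toWord
  have hne : g.toWord ≠ [] := by simpa using hg
  obtain ⟨⟨s, b⟩, L, hL⟩ := List.exists_cons_of_ne_nil hne
  rw [hL] at hred
  obtain ⟨u, q, m, hq, hm, -, -, hsu, -⟩ := exists_magnusCoeff_of_isReduced L s b hred
  rw [← hL, FreeGroup.mk_toWord] at hsu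
  refine ⟨s :: u, ?_⟩
  rw [map_sub, magnusCoeff_one (by simp), sub_zero, hsu]
  exact mul_ne_zero (mul_ne_zero (by split_ifs <;> simp) hm.ne') hq

end Faithful
-- The Magnus ordering.
section Order

variable {S : Type*} [LinearOrder S]

/-- The word `w` carries the leading coefficient of the Magnus expansion of `a`, and this
coefficient is positive. -/
structure IsPosLeading (w : List S) (a : MonoidAlgebra ℤ (FreeGroup S)) : Prop where
  pos : 0 < magnusCoeff w a
  short : ∀ v : List S, v.length < w.length → magnusCoeff v a = 0
  lex : ∀ v : List S, v.length = w.length → w < v → magnusCoeff v a = 0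

theorem IsPosLeading.congr {w : List S} {a b : MonoidAlgebra ℤ (FreeGroup S)}
    (ha : IsPosLeading w a)
    (h : ∀ v : List S, v.length ≤ w.length → magnusCoeff v a = magnusCoeff v b) :
    IsPosLeading w b where
  pos := h w le_rfl ▸ ha.pos
  short v hv := h v hv.le ▸ ha.short v hv
  lex v hv hw := h v hv.le ▸ ha.lex v hv hw

/-- The sum leads with the shorter of the two words or, at equal length, the lexicographically
larger one. The length bounds let `MagnusPos.mul` discard terms of higher degree. -/
theorem IsPosLeading.add {w w' : List S} {a b : MonoidAlgebra ℤ (FreeGroup S)}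
    (ha : IsPosLeading w a) (hb : IsPosLeading w' b) :
    ∃ u : List S, u.length ≤ w.length ∧ u.length ≤ w'.length ∧ IsPosLeading u (a + b) := by
  rcases lt_trichotomy w.length w'.length with h | h | h
  · exact ⟨w, le_rfl, h.le, ha.congr fun v hv => by
      rw [map_add, hb.short v (by omega), add_zero]⟩
  · rcases lt_trichotomy w w' with h' | h' | h'
    · refine ⟨w', h.ge, le_rfl, ?_, fun v hv => ?_, fun v hv hw => ?_⟩
      · rw [map_add, ha.lex w' h.symm h', zero_add]; exact hb.pos
      · rw [map_add, ha.short v (by omega), hb.short v hv, add_zero]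
      · rw [map_add, ha.lex v (by omega) (h'.trans hw), hb.lex v hv hw, add_zero]
    · subst h'
      refine ⟨w, le_rfl, le_rfl, ?_, fun v hv => ?_, fun v hv hw => ?_⟩
      · rw [map_add]; exact add_pos ha.pos hb.pos
      · rw [map_add, ha.short v hv, hb.short v hv, add_zero]
      · rw [map_add, ha.lex v hv hw, hb.lex v hv hw, add_zero]
    · refine ⟨w, le_rfl, h.le, ?_, fun v hv => ?_, fun v hv hw => ?_⟩
      · rw [map_add, hb.lex w h h', add_zero]; exact ha.pos
      · rw [map_add, ha.short v hv, hb.short v (by omega), add_zero]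
      · rw [map_add, ha.lex v hv hw, hb.lex v (by omega) (h'.trans hw), add_zero]
  · exact ⟨w', h.le, le_rfl, hb.congr fun v hv => by
      rw [map_add, ha.short v (by omega), zero_add]⟩

theorem exists_isPosLeading_or_neg {a : MonoidAlgebra ℤ (FreeGroup S)} {w : List S}
    (hw : magnusCoeff w a ≠ 0) : ∃ u, IsPosLeading u a ∨ IsPosLeading u (-a) := by
  classical
  have hex : ∃ d, ∃ w : List S, w.length = d ∧ magnusCoeff w a ≠ 0 := ⟨_, w, rfl, hw⟩
  have hshort : ∀ v : List S, v.length < Nat.find hex → magnusCoeff v a = 0 := fun v hv =>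
    by_contra fun h => Nat.find_min hex hv ⟨v, rfl, h⟩
  obtain ⟨u, ⟨hu, hua⟩, hmax⟩ := (finite_setOf_magnusCoeff_ne_zero (Nat.find hex) a).exists_maximal
    (Nat.find_spec hex)
  have hlex : ∀ v : List S, v.length = u.length → u < v → magnusCoeff v a = 0 := fun v hv huv =>
    by_contra fun h => huv.not_ge (hmax ⟨hv.trans hu, h⟩ huv.le)
  refine ⟨u, ?_⟩
  rcases lt_or_gt_of_ne hua with h | h
  · refine Or.inr ⟨by rwa [map_neg, neg_pos], fun v hv => ?_, fun v hv hw => ?_⟩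
    · rw [map_neg, hshort v (by omega), neg_zero]
    · rw [map_neg, hlex v hv hw, neg_zero]
  · exact Or.inl ⟨h, fun v hv => hshort v (by omega), hlex⟩

/-- The positive cone of the Magnus ordering of a free group on an ordered basis. -/
def MagnusPos (g : FreeGroup S) : Prop := ∃ w : List S, IsPosLeading w (of ℤ _ g - 1)

theorem not_magnusPos_one : ¬ MagnusPos (1 : FreeGroup S) := by
  rintro ⟨w, hw⟩
  have := hw.pos
  rw [map_one, sub_self, map_zero] at this
  exact this.false

theorem MagnusPos.mul {g h : FreeGroup S} (hg : MagnusPos g) (hh : MagnusPos h) :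
    MagnusPos (g * h) := by
  obtain ⟨w, hw⟩ := hg
  obtain ⟨w', hw'⟩ := hh
  obtain ⟨u, -, hu, hpos⟩ := hw.add hw'
  refine ⟨u, hpos.congr fun v hv => ?_⟩
  -- The product term has no coefficients up to the leading degree of the sum, since `g - 1` has
  -- augmentation zero.
  have : of ℤ _ (g * h) - 1 = (of ℤ _ g - 1) + (of ℤ _ h - 1) +
      (of ℤ (FreeGroup S) g - 1) * (of ℤ _ h - 1) := by
    rw [map_mul]; noncomm_ring
  rw [this, map_add _ _ (_ * _), magnusCoeff_mul hw'.short v (hv.trans hu), map_sub (augmentation S),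
    augmentation_of, map_one, sub_self, zero_mul, add_zero]

theorem magnusPos_or_inv {g : FreeGroup S} (hg : g ≠ 1) : MagnusPos g ∨ MagnusPos g⁻¹ := by
  obtain ⟨w, hw⟩ := exists_magnusCoeff_ne_zero hg
  obtain ⟨u, hu | hu⟩ := exists_isPosLeading_or_neg hw
  · exact Or.inl ⟨u, hu⟩
  · refine Or.inr ⟨u, hu.congr fun v hv => ?_⟩
    have hinv : of ℤ _ g⁻¹ * of ℤ (FreeGroup S) g = 1 := by
      rw [← map_mul, inv_mul_cancel, map_one]
    have : of ℤ _ g⁻¹ - 1 = -(of ℤ _ g - 1) +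
        (of ℤ (FreeGroup S) g⁻¹ - 1) * -(of ℤ _ g - 1) := by
      simp only [mul_neg, mul_sub, sub_mul, hinv]
      noncomm_ring
    rw [this, map_add, magnusCoeff_mul hu.short v hv, map_sub (augmentation S),
    augmentation_of, map_one, sub_self, zero_mul, add_zero]

/-- The Magnus ordering is preserved by an endomorphism that induces an order isomorphism of
the basis modulo commutators. -/
theorem MagnusPos.map {g : FreeGroup S} (hg : MagnusPos g) (p : S ≃o S)
    (ψ : FreeGroup S →* FreeGroup S)
    (hψ : ∀ s q, magnusCoeff [q] (of ℤ _ (ψ (FreeGroup.of s))) = if q = p s then 1 else 0) :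
    MagnusPos (ψ g) := by
  obtain ⟨w, hw⟩ := hg
  have hmap := magnusCoeff_map p.toEquiv ψ hψ w.length _ hw.short
  have hsub : of ℤ _ (ψ g) - 1 = mapDomainRingHom ℤ ψ (of ℤ _ g - 1) := by
    rw [map_sub, map_one]; simp
  have hcoeff : ∀ v : List S, v.length ≤ w.length →
      magnusCoeff v (of ℤ _ (ψ g) - 1) = magnusCoeff (v.map p.symm) (of ℤ _ g - 1) := by
    intro v hv
    rw [hsub, ← hmap _ (by simpa using hv), List.map_map]
    congr
    exact (List.map_id'' (fun x => p.apply_symm_apply x) v).symm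
  refine ⟨w.map p, ?_, fun v hv => ?_, fun v hv hwv => ?_⟩
  · rw [hsub]
    exact (hmap w le_rfl).symm ▸ hw.pos
  · rw [List.length_map] at hv
    rw [hcoeff v hv.le]
    exact hw.short _ (by simpa using hv)
  · rw [List.length_map] at hv
    rw [hcoeff v hv.le]
    refine hw.lex _ (by simpa using hv) ?_
    have := List.map_lt (f := p.symm) (fun x y h => p.symm.lt_iff_lt.2 h) hwv
    rwa [List.map_map, List.map_id'' (f := p.symm ∘ p) (fun x => p.symm_apply_apply x)] at this

/-- Coefficients at words of length one are additive. -/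
theorem magnusCoeff_singleton_mul (q : S) (g h : FreeGroup S) :
    magnusCoeff [q] (of ℤ _ (g * h)) = magnusCoeff [q] (of ℤ _ g) + magnusCoeff [q] (of ℤ _ h) := by
  simp only [magnusCoeff_cons, map_mul, foxDeriv_mul, map_add, augmentation_of, one_smul,
    magnusCoeff_nil, mul_one]

theorem magnusCoeff_singleton_conj (q s : S) (g : FreeGroup S) :
    magnusCoeff [q] (of ℤ _ (g * FreeGroup.of s * g⁻¹)) = if q = s then 1 else 0 := by
  have h : magnusCoeff [q] (of ℤ _ (g * g⁻¹)) = 0 := by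
    rw [mul_inv_cancel, map_one, magnusCoeff_one (by simp)]
  rw [magnusCoeff_singleton_mul] at h
  rw [magnusCoeff_singleton_mul, magnusCoeff_singleton_mul, add_right_comm, h, zero_add,
    magnusCoeff_cons, foxDeriv_of, foxDerivGroup_of, magnusCoeff_nil]
  split_ifs <;> simp

end Order

end MagnusOrder

/-! ### Orderings from the splitting of a free group over one exponent sum. -/

noncomputable section FixedGenerator

/-- A positive cone that is invariant under an automorphism makes it order-preserving. -/
theorem isOrderPreservingAut_of_cone {G : Type*} [Group G] (φ : MulAut G) (P : G → Prop)
    (hone : ¬ P 1) (hmul : ∀ g h, P g → P h → P (g * h)) (htotal : ∀ g, g ≠ 1 → P g ∨ P g⁻¹)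
    (hconj : ∀ g h, P g → P (h * g * h⁻¹)) (hφ : ∀ g, P g → P (φ g)) :
    IsOrderPreservingAut φ := by
  refine ⟨fun f g => P (f⁻¹ * g), ⟨fun f => ?_, fun f g h hfg hgh => ?_, fun f g => ?_,
    fun f g h hfg => ?_, fun f g h hfg => ?_⟩, fun f g => ?_⟩
  · rwa [inv_mul_cancel]
  · have := hmul _ _ hfg hgh
    rwa [mul_assoc, mul_inv_cancel_left] at this
  · by_cases h : f = g
    · exact Or.inr (Or.inl h)
    · rcases htotal (f⁻¹ * g) (fun h' => h (inv_mul_eq_one.1 h')) with h' | h'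
      · exact Or.inl h'
      · refine Or.inr (Or.inr ?_)
        rwa [mul_inv_rev, inv_inv] at h'
  · rwa [mul_inv_rev, mul_assoc, inv_mul_cancel_left]
  · have := hconj _ h⁻¹ hfg
    rw [inv_inv] at this
    simpa only [mul_inv_rev, mul_assoc] using this
  · change P (f⁻¹ * g) ↔ P ((φ f)⁻¹ * φ g)
    rw [← map_inv, ← map_mul]
    -- Forward invariance of the cone suffices: were the inverse positive, its image and `h` would
    -- multiply to a positive identity.
    refine ⟨hφ _, fun h => ?_⟩
    by_cases h1 : f⁻¹ * g = 1
    · rw [h1, map_one] at h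
      exact absurd h hone
    · refine (htotal _ h1).resolve_right fun h' => hone ?_
      have := hmul _ _ h (hφ _ h')
      rwa [← map_mul, mul_inv_cancel, map_one] at this

/-- The exponent sum of the generator `x_o`. -/
def exponentSum {ι : Type*} [DecidableEq ι] (o : ι) : FreeGroup ι →* Multiplicative ℤ :=
  FreeGroup.lift fun j => if j = o then Multiplicative.ofAdd 1 else 1

/-- The shift automorphisms of the free group on the conjugates of the generators other than `x_o`
by the powers of `x_o`. -/
def shiftAut {ι : Type*} (o : ι) : Multiplicative ℤ →* MulAut (FreeGroup ({j : ι // j ≠ o} × ℤ)) where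
  toFun k := FreeGroup.freeGroupCongr ((Equiv.refl _).prodCongr (Equiv.addRight k.toAdd))
  map_one' := by
    apply mulAut_freeGroup_ext
    rintro ⟨j, k⟩
    simp
  map_mul' k l := by
    apply mulAut_freeGroup_ext
    rintro ⟨j, m⟩
    simp [add_comm, add_left_comm]

theorem shiftAut_of {ι : Type*} (o : ι) (k : Multiplicative ℤ) (s : {j : ι // j ≠ o} × ℤ) :
    shiftAut o k (FreeGroup.of s) = FreeGroup.of (s.1, s.2 + k.toAdd) := by
  simp [shiftAut, Prod.map]

variable {ι : Type*} [DecidableEq ι]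

/-- The splitting of a free group over the exponent sum of the generator `x_o`. -/
def splitHom (o : ι) :
    FreeGroup ι →* FreeGroup ({j : ι // j ≠ o} × ℤ) ⋊[shiftAut o] Multiplicative ℤ :=
  FreeGroup.lift fun j =>
    if h : j = o then SemidirectProduct.inr (Multiplicative.ofAdd 1)
    else SemidirectProduct.inl (FreeGroup.of (⟨j, h⟩, 0))

/-- The inverse of `splitHom`. -/
def splitInvHom (o : ι) :
    FreeGroup ({j : ι // j ≠ o} × ℤ) ⋊[shiftAut o] Multiplicative ℤ →* FreeGroup ι :=
  SemidirectProduct.lift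
    (FreeGroup.lift fun s => FreeGroup.of o ^ s.2 * FreeGroup.of (s.1 : ι) * (FreeGroup.of o ^ s.2)⁻¹)
    (zpowersHom _ (FreeGroup.of o)) (by
      intro k
      ext s
      have h : ∀ y, (MulAut.conj (FreeGroup.of o) ^ k.toAdd) y =
          FreeGroup.of o ^ k.toAdd * y * (FreeGroup.of o ^ k.toAdd)⁻¹ := fun y => by
        rw [← map_zpow, MulAut.conj_apply]
      simp only [MonoidHom.comp_apply, MulEquiv.coe_toMonoidHom, shiftAut_of,
        FreeGroup.lift_apply_of, zpowersHom_apply, map_zpow, h]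
      group)

theorem splitInvHom_splitHom (o : ι) (x : FreeGroup ι) : splitInvHom o (splitHom o x) = x := by
  suffices (splitInvHom o).comp (splitHom o) = MonoidHom.id _ from DFunLike.congr_fun this x
  ext j
  by_cases h : j = o
  · subst h
    simp [splitHom, splitInvHom]
  · simp [splitHom, splitInvHom, h]

theorem splitHom_splitInvHom (o : ι)
    (x : FreeGroup ({j : ι // j ≠ o} × ℤ) ⋊[shiftAut o] Multiplicative ℤ) :
    splitHom o (splitInvHom o x) = x := by
  suffices (splitHom o).comp (splitInvHom o) = MonoidHom.id _ from DFunLike.congr_fun this x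
  apply SemidirectProduct.hom_ext
  · apply FreeGroup.ext_hom
    rintro ⟨⟨j, hj⟩, k⟩
    have ho : splitHom o (FreeGroup.of o) = SemidirectProduct.inr (Multiplicative.ofAdd 1) := by
      simp [splitHom]
    have hj' : splitHom o (FreeGroup.of j) =
        SemidirectProduct.inl (FreeGroup.of (⟨j, hj⟩, 0)) := by
      simp [splitHom, hj]
    simp only [MonoidHom.comp_apply, splitInvHom, SemidirectProduct.lift_inl,
      FreeGroup.lift_apply_of, map_mul, map_inv, map_zpow, ho, hj', MonoidHom.id_apply]
    rw [← map_zpow, ← map_inv, ← SemidirectProduct.inl_aut, shiftAut_of]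
    simp [← ofAdd_zsmul]
  · apply MonoidHom.ext_mint
    simp [splitInvHom, splitHom]

theorem splitHom_right (o : ι) (x : FreeGroup ι) : (splitHom o x).right = exponentSum o x := by
  suffices SemidirectProduct.rightHom.comp (splitHom o) = exponentSum o from
    DFunLike.congr_fun this x
  ext j
  by_cases h : j = o
  · subst h
    simp [splitHom, exponentSum]
  · simp [splitHom, exponentSum, h]

theorem splitHom_eq_inl (o : ι) {x : FreeGroup ι} (hx : exponentSum o x = 1) :
    splitHom o x = SemidirectProduct.inl (splitHom o x).left := by
  rw [← splitHom_right] at hx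
  ext
  · simp
  · simp [hx]

/-- The cone of elements that have positive exponent sum, or exponent sum zero and a Magnus-positive
component. -/
def FiberPos (o : ι) [LinearOrder ({j : ι // j ≠ o} × ℤ)] (x : FreeGroup ι) : Prop :=
  0 < (exponentSum o x).toAdd ∨ exponentSum o x = 1 ∧ MagnusPos (splitHom o x).left

/-- The restriction of `χ` to the kernel sends each basis element `s` to a kernel conjugate of `p
s`, so `MagnusPos.map` applies. Stated for endomorphisms with a general `u` to cover both the given
automorphism and inner ones. -/
theorem FiberPos.map {o : ι} [LinearOrder ({j : ι // j ≠ o} × ℤ)] {x : FreeGroup ι}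
    (hx : FiberPos o x) (χ : FreeGroup ι →* FreeGroup ι) (π : Equiv.Perm ι) (hπ : π o = o)
    (u : ι → FreeGroup ι) (hu : ∀ j, χ (FreeGroup.of j) = u j * FreeGroup.of (π j) * (u j)⁻¹)
    (p : ({j : ι // j ≠ o} × ℤ) ≃o ({j : ι // j ≠ o} × ℤ))
    (hp₁ : ∀ s, ((p s).1 : ι) = π s.1)
    (hp₂ : ∀ s, (p s).2 = s.2 + (exponentSum o (u s.1)).toAdd) :
    FiberPos o (χ x) := by
  have hτ : ∀ y, exponentSum o (χ y) = exponentSum o y := by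
    intro y
    suffices (exponentSum o).comp χ = exponentSum o from DFunLike.congr_fun this y
    ext j
    have : π j = o ↔ j = o := by
      nth_rewrite 1 [← hπ]
      exact π.injective.eq_iff
    simp [hu, exponentSum, this]
  rcases hx with hx | ⟨hx, hpos⟩
  · exact Or.inl (by rwa [hτ])
  refine Or.inr ⟨by rw [hτ, hx], ?_⟩
  set ψ : FreeGroup ({j : ι // j ≠ o} × ℤ) →* FreeGroup ({j : ι // j ≠ o} × ℤ) :=
    FreeGroup.lift fun s =>
      (splitHom o (χ (splitInvHom o (SemidirectProduct.inl (FreeGroup.of s))))).left with hψ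
  have hτinl : ∀ l, exponentSum o (χ (splitInvHom o (SemidirectProduct.inl l))) = 1 := by
    intro l
    rw [hτ, ← splitHom_right, splitHom_splitInvHom, SemidirectProduct.right_inl]
  have hψinl : ∀ l, SemidirectProduct.inl (ψ l) =
      splitHom o (χ (splitInvHom o (SemidirectProduct.inl l))) := by
    intro l
    suffices SemidirectProduct.inl.comp ψ =
        (splitHom o).comp (χ.comp ((splitInvHom o).comp SemidirectProduct.inl)) from
      DFunLike.congr_fun this l
    apply FreeGroup.ext_hom
    intro s
    simp only [MonoidHom.comp_apply, hψ, FreeGroup.lift_apply_of]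
    exact (splitHom_eq_inl o (hτinl _)).symm
  have hleft : (splitHom o (χ x)).left = ψ (splitHom o x).left := by
    apply SemidirectProduct.inl_injective (φ := shiftAut o)
    rw [hψinl, ← splitHom_eq_inl o hx, splitInvHom_splitHom,
      ← splitHom_eq_inl o (by rw [hτ, hx])]
  rw [hleft]
  refine hpos.map p ψ fun s q => ?_
  obtain ⟨l, hl⟩ : ∃ l, ψ (FreeGroup.of s) = l * FreeGroup.of (p s) * l⁻¹ := by
    -- The conjugator `w` has exponent sum `(p s).2`; splitting off that power of `x_o` turns `x_j`
    -- into the basis element `p s` and leaves a conjugator in the kernel.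
    obtain ⟨w, hw⟩ : ∃ w, w = χ (FreeGroup.of o) ^ s.2 * u s.1 := ⟨_, rfl⟩
    have hsplit : splitInvHom o (SemidirectProduct.inl (FreeGroup.of s)) =
        FreeGroup.of o ^ s.2 * FreeGroup.of (s.1 : ι) * (FreeGroup.of o ^ s.2)⁻¹ := by
      simp [splitInvHom]
    have hχ : χ (splitInvHom o (SemidirectProduct.inl (FreeGroup.of s))) =
        w * FreeGroup.of (p s).1.1 * w⁻¹ := by
      rw [hsplit, map_mul, map_mul, map_inv, map_zpow, hu s.1, hw, hp₁]
      group
    have hτw : (exponentSum o w).toAdd = (p s).2 := by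
      rw [hw, map_mul, map_zpow, hτ, hp₂]
      simp [exponentSum]
    refine ⟨(splitHom o w).left, SemidirectProduct.inl_injective (φ := shiftAut o) ?_⟩
    have hof : splitHom o (FreeGroup.of (p s).1.1) =
        SemidirectProduct.inl (FreeGroup.of ((p s).1, 0)) := by
      simp [splitHom, (p s).1.2]
    have hsw : splitHom o w = SemidirectProduct.inl (splitHom o w).left *
        SemidirectProduct.inr (exponentSum o w) := by
      rw [← splitHom_right, SemidirectProduct.inl_left_mul_inr_right]
    have hshift : SemidirectProduct.inr (exponentSum o w) *
        SemidirectProduct.inl (FreeGroup.of ((p s).1, 0)) *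
          (SemidirectProduct.inr (exponentSum o w))⁻¹ =
        SemidirectProduct.inl (φ := shiftAut o) (FreeGroup.of (p s)) := by
      rw [← map_inv, ← SemidirectProduct.inl_aut, shiftAut_of, hτw, zero_add]
    rw [hψinl, hχ, map_mul, map_mul, map_inv, hof, map_mul, map_mul, map_inv, ← hshift]
    nth_rewrite 1 2 [hsw]
    group
  rw [hl, magnusCoeff_singleton_conj]

/-- An automorphism of a free group that fixes the conjugacy class of one generator `x_o` and
permutes those of the others is order-preserving if there is an invariant ordering of the
conjugates of the other generators by the powers of `x_o`. -/
theorem isOrderPreservingAut_of_strictMono {Λ : Type*} [LinearOrder Λ] (o : ι)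
    (φ : MulAut (FreeGroup ι)) (π : Equiv.Perm ι) (hπ : π o = o) (u : ι → FreeGroup ι)
    (hu : ∀ j, φ (FreeGroup.of j) = u j * FreeGroup.of (π j) * (u j)⁻¹) (v : ι → ℤ → Λ)
    (hinj : ∀ i j k l, i ≠ o → j ≠ o → v i k = v j l → i = j ∧ k = l)
    (hshift : ∀ i j k l m, v i k < v j l → v i (k + m) < v j (l + m))
    (hmono : ∀ i j k l, i ≠ o → j ≠ o → v i k < v j l →
      v (π i) (k + (exponentSum o (u i)).toAdd) < v (π j) (l + (exponentSum o (u j)).toAdd)) :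
    IsOrderPreservingAut φ := by
  let V : {j : ι // j ≠ o} × ℤ → Λ := fun s => v s.1 s.2
  have hV : Function.Injective V := by
    rintro ⟨⟨i, hi⟩, k⟩ ⟨⟨j, hj⟩, l⟩ h
    obtain ⟨rfl, rfl⟩ := hinj i j k l hi hj h
    rfl
  let _ : LinearOrder ({j : ι // j ≠ o} × ℤ) := LinearOrder.lift' V hV
  have hπ' : ∀ j, j ≠ o ↔ π j ≠ o := by
    intro j
    nth_rewrite 2 [← hπ]
    exact π.injective.ne_iff.symm
  have key : ∀ (π : Equiv.Perm ι) (hπ : ∀ j, j ≠ o ↔ π j ≠ o) (m : ι → ℤ),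
      (∀ i j k l, i ≠ o → j ≠ o → v i k < v j l → v (π i) (k + m i) < v (π j) (l + m j)) →
      ∃ p : ({j : ι // j ≠ o} × ℤ) ≃o ({j : ι // j ≠ o} × ℤ),
        (∀ s, ((p s).1 : ι) = π s.1) ∧ ∀ s, (p s).2 = s.2 + m s.1 := by
    intro π hπ m hm
    let e : ({j : ι // j ≠ o} × ℤ) ≃ ({j : ι // j ≠ o} × ℤ) :=
      { toFun := fun s => (⟨π s.1, (hπ _).1 s.1.2⟩, s.2 + m s.1)
        invFun := fun s => (⟨π.symm s.1, (hπ _).2 (by simpa using s.1.2)⟩,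
          s.2 - m (π.symm s.1))
        left_inv := fun s => by simp
        right_inv := fun s => by simp }
    have he : StrictMono e := fun s t hst => hm _ _ _ _ s.1.2 t.1.2 hst
    exact ⟨{ toEquiv := e, map_rel_iff' := he.le_iff_le }, fun s => rfl, fun s => rfl⟩
  refine isOrderPreservingAut_of_cone φ (FiberPos o) ?_ ?_ ?_ ?_ ?_
  · rintro (h | ⟨-, h⟩)
    · simp at h
    · rw [map_one] at h
      exact not_magnusPos_one h
  · rintro g h (hg | ⟨hg, hg'⟩) (hh | ⟨hh, hh'⟩)
    · exact Or.inl (by rw [map_mul, toAdd_mul]; exact add_pos hg hh)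
    · exact Or.inl (by rwa [map_mul, hh, mul_one])
    · exact Or.inl (by rwa [map_mul, hg, one_mul])
    · refine Or.inr ⟨by rw [map_mul, hg, hh, one_mul], ?_⟩
      rw [map_mul, SemidirectProduct.mul_left, splitHom_right, hg, map_one]
      exact hg'.mul hh'
  · intro g hg
    rcases lt_trichotomy (exponentSum o g).toAdd 0 with h | h | h
    · exact Or.inr (Or.inl (by rw [map_inv, toAdd_inv]; exact neg_pos.2 h))
    · have h1 : exponentSum o g = 1 := h
      have hne : (splitHom o g).left ≠ 1 := by
        intro hl
        apply hg
        rw [← splitInvHom_splitHom o g, splitHom_eq_inl o h1, hl, map_one, map_one]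
      refine (magnusPos_or_inv hne).imp (fun h => Or.inr ⟨h1, h⟩) fun h => Or.inr ⟨?_, ?_⟩
      · rw [map_inv, h1, inv_one]
      · rw [map_inv, SemidirectProduct.inv_left, splitHom_right, h1, inv_one, map_one]
        exact h
    · exact Or.inl (Or.inl h)
  · intro g h hg
    -- Conjugation by `h` is the case of trivial permutation and constant conjugator.
    obtain ⟨p, hp₁, hp₂⟩ := key 1 (fun _ => Iff.rfl) (fun _ => (exponentSum o h).toAdd)
      (fun i j k l _ _ => hshift i j k l _)
    exact hg.map (MulAut.conj h).toMonoidHom 1 rfl (fun _ => h) (fun j => rfl) p hp₁ hp₂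
  · intro g hg
    obtain ⟨p, hp₁, hp₂⟩ := key π hπ' (fun j => (exponentSum o (u j)).toAdd) hmono
    exact hg.map φ.toMonoidHom π hπ u hu p hp₁ hp₂

end FixedGenerator

/-! ### Permutations and conjugators of braids. -/

/-- The braid `β` acts by `x_j ↦ u_j x_{π(j)} u_j⁻¹`. -/
def BraidGroup.ActsBy {n : ℕ} (β : BraidGroup n) (π : Equiv.Perm (Fin n))
    (u : Fin n → FreeGroup (Fin n)) : Prop :=
  ∀ j, β.toAut (FreeGroup.of j) = u j * FreeGroup.of (π j) * (u j)⁻¹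

namespace BraidGroup

variable {n : ℕ}

theorem ActsBy.one : ActsBy (1 : BraidGroup n) 1 (fun _ => 1) := by
  intro j
  simp [toAut]

theorem ActsBy.mul {β γ : BraidGroup n} {π ρ : Equiv.Perm (Fin n)}
    {u w : Fin n → FreeGroup (Fin n)} (hβ : β.ActsBy π u) (hγ : γ.ActsBy ρ w) :
    (β * γ).ActsBy (ρ * π) (fun j => γ.toAut (u j) * w (π j)) := by
  intro j
  rw [toAut_mul_apply, hβ, map_mul, map_mul, map_inv, hγ, Equiv.Perm.mul_apply]
  group

theorem ActsBy.inv {β : BraidGroup n} {π : Equiv.Perm (Fin n)} {u : Fin n → FreeGroup (Fin n)}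
    (hβ : β.ActsBy π u) : β⁻¹.ActsBy π⁻¹ (fun j => (β⁻¹.toAut (u (π⁻¹ j)))⁻¹) := by
  intro j
  have h : ∀ x, β⁻¹.toAut (β.toAut x) = x := fun x => by
    rw [← toAut_mul_apply, mul_inv_cancel]
    simp [toAut]
  have := h (FreeGroup.of (π⁻¹ j))
  rw [hβ, map_mul, map_mul, map_inv, ← Equiv.Perm.mul_apply, mul_inv_cancel,
    Equiv.Perm.one_apply] at this
  rw [← this]
  group

theorem ActsBy.gen (i : Fin (n - 1)) :
    ActsBy (gen i : BraidGroup n) (Equiv.swap ⟨i, by omega⟩ ⟨i + 1, by omega⟩)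
      (fun j => if (j : ℕ) = i then FreeGroup.of j else 1) := by
  intro j
  rw [toAut_gen, artinGen, artinAut_of, Equiv.swap_apply_def]
  simp only [Fin.ext_iff]
  by_cases h : (j : ℕ) = i
  · obtain ⟨j, hj⟩ := j
    simp only at h
    subst h
    simp
  · by_cases h' : (j : ℕ) = i + 1
    · simp [h']
    · simp [h, h']

theorem exists_actsBy (β : BraidGroup n) : ∃ π u, β.ActsBy π u := by
  induction β using PresentedGroup.induction_on with
  | _ z =>
    induction z using FreeGroup.induction_on with
    | C1 => exact ⟨_, _, map_one (PresentedGroup.mk (braidRels n)) ▸ ActsBy.one⟩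
    | of i => exact ⟨_, _, ActsBy.gen i⟩
    | inv_of i _ =>
      exact ⟨_, _, map_inv (PresentedGroup.mk (braidRels n)) _ ▸ (ActsBy.gen i).inv⟩
    | mul x y hx hy =>
      obtain ⟨π, u, hx⟩ := hx
      obtain ⟨ρ, w, hy⟩ := hy
      exact ⟨_, _, map_mul (PresentedGroup.mk (braidRels n)) x y ▸ hx.mul hy⟩

theorem incl_gen {m : ℕ} (h : m ≤ n) (i : Fin (m - 1)) :
    incl h (BraidGroup.gen i) = BraidGroup.gen (Fin.castLE (Nat.sub_le_sub_right h 1) i) :=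
  lift_gen _ _ _ i

/-- Every permutation that fixes the last point is induced by a braid on the other strands. -/
theorem exists_incl_actsBy {m : ℕ} (π : Equiv.Perm (Fin (m + 2)))
    (hπ : π (Fin.last (m + 1)) = Fin.last (m + 1)) :
    ∃ (α : BraidGroup (m + 1)) (u : _), (incl (Nat.le_succ (m + 1)) α).ActsBy π u := by
  have key : ∀ ρ : Equiv.Perm (Fin (m + 1)), ∃ (α : BraidGroup (m + 1)) (π : _) (u : _),
      (incl (Nat.le_succ (m + 1)) α).ActsBy π u ∧ ∀ j : Fin (m + 1), π j.castSucc = (ρ j).castSucc := by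
    intro ρ
    have hρ : ρ ∈ Submonoid.closure
        (Set.range fun i : Fin m => Equiv.swap i.castSucc i.succ) := by
      rw [Equiv.Perm.mclosure_swap_castSucc_succ]
      trivial
    induction hρ using Submonoid.closure_induction with
    | mem ρ hρ =>
      obtain ⟨i, rfl⟩ := hρ
      have h := ActsBy.gen (n := m + 2) (Fin.castLE (by omega) i)
      rw [← incl_gen (m := m + 1) (Nat.le_succ (m + 1)) i] at h
      refine ⟨_, _, _, h, fun j => ?_⟩
      simp only [Equiv.swap_apply_def, Fin.ext_iff, Fin.val_castSucc, Fin.val_succ, Fin.val_castLE,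
        apply_ite Fin.val, apply_ite Fin.castSucc]
    | one =>
      have h := ActsBy.one (n := m + 2)
      rw [← map_one (incl (Nat.le_succ (m + 1)))] at h
      exact ⟨_, _, _, h, fun j => rfl⟩
    | mul ρ ρ' _ _ h h' =>
      obtain ⟨α, π, u, hu, hπ⟩ := h
      obtain ⟨α', π', u', hu', hπ'⟩ := h'
      -- The factors are reversed because the action is a right action.
      have h := hu'.mul hu
      rw [← map_mul] at h
      refine ⟨_, _, _, h, fun j => ?_⟩
      rw [Equiv.Perm.mul_apply, hπ', hπ, Equiv.Perm.mul_apply]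
  have hne : ∀ j : Fin (m + 1), π j.castSucc ≠ Fin.last (m + 1) := fun j h =>
    (Fin.castSucc_lt_last j).ne (π.injective (h.trans hπ.symm))
  have hne' : ∀ j : Fin (m + 1), π.symm j.castSucc ≠ Fin.last (m + 1) := fun j h =>
    (Fin.castSucc_lt_last j).ne (by rw [← hπ, ← h, Equiv.apply_symm_apply])
  obtain ⟨α, π', u, hu, hπ'⟩ := key
    { toFun := fun j => (π j.castSucc).castPred (hne j)
      invFun := fun j => (π.symm j.castSucc).castPred (hne' j)
      left_inv := fun j => by simp
      right_inv := fun j => by simp }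
  have hπ'' : ∀ j : Fin (m + 1), π' j.castSucc = π j.castSucc := fun j => by rw [hπ']; simp
  have hlast : π' (Fin.last (m + 1)) = Fin.last (m + 1) := by
    by_contra h
    obtain ⟨j, hj⟩ := Fin.exists_castSucc_eq.2 h
    obtain ⟨i, hi⟩ := Fin.exists_castSucc_eq.2 (hne' j)
    have h1 : π' i.castSucc = π' (Fin.last (m + 1)) := by
      rw [hπ'', hi, Equiv.apply_symm_apply, hj]
    exact (Fin.castSucc_lt_last i).ne (π'.injective h1)
  obtain rfl : π' = π := by
    ext j
    induction j using Fin.lastCases with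
    | last => rw [hlast, hπ]
    | cast j => rw [hπ'']
  exact ⟨α, u, hu⟩

/-! ### Order-preserving braids with trivial permutation or a transposition. -/

theorem toLex_add_lt_toLex_add {κ : Type*} [LinearOrder κ] (D : κ → ℤ) {a b : κ} {k l : ℤ}
    (h : toLex (a, k) < toLex (b, l)) : toLex (a, k + D a) < toLex (b, l + D b) := by
  rw [Prod.Lex.toLex_lt_toLex] at h ⊢
  refine h.imp id fun h => ⟨h.1, ?_⟩
  obtain ⟨rfl, h⟩ := h
  exact add_lt_add_left h _

/-- Pure braids are order-preserving. -/
theorem ActsBy.isOrderPreserving_of_one [NeZero n] {β : BraidGroup n}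
    {u : Fin n → FreeGroup (Fin n)} (hβ : β.ActsBy 1 u) : β.IsOrderPreserving := by
  refine isOrderPreservingAut_of_strictMono (0 : Fin n) β.toAut 1 rfl u hβ
    (fun j k => toLex (j, k)) (fun i j k l _ _ h => ?_) (fun i j k l m h => ?_)
    (fun i j k l _ _ h => ?_)
  · simpa using h
  · exact toLex_add_lt_toLex_add (fun _ => m) h
  · exact toLex_add_lt_toLex_add (fun j => (exponentSum 0 (u j)).toAdd) h

/-- A braid whose permutation is a transposition is order-preserving if some fixed strand has odd
linking number with the union of the two other strands. -/
theorem ActsBy.isOrderPreserving_of_swap {β : BraidGroup n} {a b o : Fin n}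
    {u : Fin n → FreeGroup (Fin n)} (hβ : β.ActsBy (Equiv.swap a b) u) (hab : a ≠ b)
    (hoa : o ≠ a) (hob : o ≠ b)
    (hodd : Odd ((exponentSum o (u a)).toAdd + (exponentSum o (u b)).toAdd)) :
    β.IsOrderPreserving := by
  set m : Fin n → ℤ := fun j => (exponentSum o (u j)).toAdd with hm
  -- The copies of `ℤ` over `a` and `b` share one line: `(a, k)` sits at `2k` and `(b, k)` at `2k +
  -- m_b - m_a`. The offset is odd, so they do not collide, and the braid translates this line by
  -- `m_a + m_b`. On every other line it translates by `2 m_j`.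
  let r : Fin n → Fin n := fun j => if j = b then a else j
  let c : Fin n → ℤ := fun j => if j = b then m b - m a else 0
  let D : Fin n → ℤ := fun j => if j = a then m a + m b else 2 * m j
  refine isOrderPreservingAut_of_strictMono o β.toAut (Equiv.swap a b)
    (Equiv.swap_apply_of_ne_of_ne hoa hob) u hβ
    (fun j k => toLex (r j, 2 * k + c j)) (fun i j k l _ _ h => ?_) (fun i j k l q h => ?_)
    (fun i j k l _ _ h => ?_)
  · obtain ⟨q, hq⟩ := hodd
    simp only [EmbeddingLike.apply_eq_iff_eq, Prod.mk.injEq, r, c] at h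
    obtain ⟨h1, h2⟩ := h
    change m a + m b = _ at hq
    split_ifs at h1 h2 with h3 h4 h4
    · exact ⟨h3.trans h4.symm, by omega⟩
    · omega
    · omega
    · exact ⟨h1, by omega⟩
  · have := toLex_add_lt_toLex_add (fun _ => 2 * q) h
    simpa only [mul_add, add_right_comm] using this
  · have hstep : ∀ i k, toLex (r (Equiv.swap a b i), 2 * (k + m i) + c (Equiv.swap a b i)) =
        toLex (r i, 2 * k + c i + D (r i)) := by
      intro i k
      congr 1
      by_cases hia : i = a
      · subst hia
        simp only [Equiv.swap_apply_left, r, c, D, if_true, if_neg hab]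
        congr 1
        ring
      · by_cases hib : i = b
        · subst hib
          simp only [Equiv.swap_apply_right, r, c, D, if_true, if_neg hab]
          congr 1
          ring
        · simp only [Equiv.swap_apply_of_ne_of_ne hia hib, r, c, D, if_neg hia, if_neg hib]
          congr 1
          ring
    change toLex (r (Equiv.swap a b i), 2 * (k + m i) + c (Equiv.swap a b i)) <
      toLex (r (Equiv.swap a b j), 2 * (l + m j) + c (Equiv.swap a b j))
    rw [hstep, hstep]
    exact toLex_add_lt_toLex_add D h

theorem ActsBy.exponentSum_toAut {β : BraidGroup n} {u : Fin n → FreeGroup (Fin n)}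
    (hβ : β.ActsBy 1 u) (o : Fin n) (x : FreeGroup (Fin n)) :
    exponentSum o (β.toAut x) = exponentSum o x := by
  suffices (exponentSum o).comp β.toAut.toMonoidHom = exponentSum o from DFunLike.congr_fun this x
  ext j
  simp [hβ j]

/-- The square of a generator adds one to the linking number of two adjacent strands. -/
theorem exists_gen_sq_actsBy (i : Fin (n - 1)) {a o : Fin n}
    (h : (a : ℕ) = i ∧ (o : ℕ) = i + 1 ∨ (o : ℕ) = i ∧ (a : ℕ) = i + 1) :
    ∃ s : Fin n → FreeGroup (Fin n), (BraidGroup.gen i * BraidGroup.gen i : BraidGroup n).ActsBy 1 s ∧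
      (exponentSum o (s a)).toAdd = 1 ∧
      ∀ j : Fin n, (j : ℕ) ≠ i → (j : ℕ) ≠ i + 1 → (exponentSum o (s j)).toAdd = 0 := by
  have hsq := (ActsBy.gen i).mul (ActsBy.gen i)
  rw [Equiv.swap_mul_self] at hsq
  refine ⟨_, hsq, ?_, fun j h1 h2 => ?_⟩
  · obtain ⟨a, ha'⟩ := a
    obtain ⟨o, ho'⟩ := o
    rcases h with ⟨ha, ho⟩ | ⟨ho, ha⟩
    · simp only at ha ho
      subst ha ho
      simp [(ActsBy.gen i) _, exponentSum]
    · simp only at ha ho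
      subst ha ho
      simp [exponentSum]
  · rw [Equiv.swap_apply_of_ne_of_ne (by simpa [Fin.ext_iff] using h1)
      (by simpa [Fin.ext_iff] using h2)]
    simp [h1]

end BraidGroup

/-! ### Adjusting the permutation and the parity of the linking number. -/

theorem mainTheorem9 (n : ℕ) (hn : 3 ≤ n) (β : BraidGroup n) :
    ∃ α : BraidGroup (n - 1),
      (β * BraidGroup.incl (Nat.sub_le n 1) α).IsOrderPreserving := by
  obtain ⟨N, rfl⟩ : ∃ N, n = N + 3 := ⟨n - 3, by omega⟩
  change ∃ α : BraidGroup (N + 2), (β * BraidGroup.incl (Nat.le_succ (N + 2)) α).IsOrderPreserving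
  obtain ⟨π, u, hβ⟩ := β.exists_actsBy
  set z : Fin (N + 3) := Fin.last (N + 2) with hz
  set a : Fin (N + 3) := π⁻¹ z with ha
  -- This permutation fixes the last point and, composed after `π`, leaves the transposition of `a`
  -- and `z`.
  obtain ⟨α₀, w, hα₀⟩ := BraidGroup.exists_incl_actsBy (m := N + 1) (Equiv.swap a z * π⁻¹) (by
    rw [Equiv.Perm.mul_apply, ← hz, ← ha, Equiv.swap_apply_left])
  have hγ := hβ.mul hα₀
  rw [inv_mul_cancel_right] at hγ
  set s := fun j => (BraidGroup.incl (Nat.le_succ (N + 2)) α₀).toAut (u j) * w (π j)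
  by_cases haz : a = z
  · rw [haz, Equiv.swap_self] at hγ
    exact ⟨α₀, BraidGroup.ActsBy.isOrderPreserving_of_one hγ⟩
  have haz' : (a : ℕ) < N + 2 := by
    have := Fin.val_lt_last haz
    exact this
  -- The strand `o` is a neighbour of `a` other than `z`: the next one if `a = 0`, the previous one
  -- otherwise. So the generator crossing `a` and `o` lies in the smaller braid group.
  obtain ⟨i, o, h⟩ : ∃ (i : Fin (N + 1)) (o : Fin (N + 3)),
      (a : ℕ) = i ∧ (o : ℕ) = i + 1 ∨ (o : ℕ) = i ∧ (a : ℕ) = i + 1 := by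
    by_cases h0 : (a : ℕ) = 0
    · exact ⟨⟨0, by omega⟩, ⟨1, by omega⟩, Or.inl ⟨h0, rfl⟩⟩
    · exact ⟨⟨a - 1, by omega⟩, ⟨a - 1, by omega⟩, Or.inr ⟨rfl, by simp only; omega⟩⟩
  have hz' : (z : ℕ) = N + 2 := rfl
  have hi := i.2
  have hoa : o ≠ a := fun h' => by rw [h'] at h; omega
  have hoz : o ≠ z := fun h' => by rw [h'] at h; omega
  by_cases hodd : Odd ((exponentSum o (s a)).toAdd + (exponentSum o (s z)).toAdd)
  · exact ⟨α₀, hγ.isOrderPreserving_of_swap haz hoa hoz hodd⟩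
  obtain ⟨t, ht, hta, ht'⟩ := BraidGroup.exists_gen_sq_actsBy (n := N + 3)
    (Fin.castLE (by omega) i : Fin (N + 2)) h
  refine ⟨α₀ * (BraidGroup.gen i * BraidGroup.gen i), ?_⟩
  rw [map_mul, map_mul, BraidGroup.incl_gen, ← mul_assoc]
  have hδ := hγ.mul ht
  rw [one_mul] at hδ
  -- The square raises the total exponent sum of `x_o` by one. The gain appears in the conjugator at
  -- `z`, since `z` is sent to `a` before the square acts.
  refine hδ.isOrderPreserving_of_swap haz hoa hoz ?_
  rw [map_mul (exponentSum o), map_mul (exponentSum o), ht.exponentSum_toAut, ht.exponentSum_toAut, toAdd_mul, toAdd_mul,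
    Equiv.swap_apply_left, Equiv.swap_apply_right, hta,
    ht' z (by rw [hz', Fin.val_castLE]; omega) (by rw [hz', Fin.val_castLE]; omega), add_zero,
    ← add_assoc]
  exact (Int.not_odd_iff_even.1 hodd).add_one
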